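/- Let $\Gamma$ be a finite directed graph (loops and parallel edges allowed) in which every vertex has exactly $d$ outgoing edges, where $d\ge 1$. Let $\Gamma_1,\dots,\Gamma_m$ be all the strongly connected components of $\Gamma$ that no edge of $\Gamma$ leaves, let $k_i$ be the greatest common divisor of the lengths of all cycles in $\Gamma_i$, and put $k=\sum_{i=1}^m k_i$. Then $\Gamma$ has a $k$-synchronizing coloring. Here a coloring of $\Gamma$ assigns to each edge one of $d$ colors so that the $d$ outgoing edges of each vertex have pairwise distinct colors; it makes $\Gamma$ a complete deterministic automaton whose alphabet $\Sigma$ is the set of colors. For a word $s$ over $\Sigma$ let $\Gamma s$ be the set of all states reached by reading $s$ from the vertices of $\Gamma$. A $k$-synchronizing word of a coloring is a nonempty word $s$ with $|\Gamma s|=k$ such that $|\Gamma t|\ge k$ for every word $t$ over $\Sigma$. A coloring is $k$-synchronizing if it has a $k$-synchronizing word and $k$ is minimal, i.e. no coloring of $\Gamma$ has a $k'$-synchronizing word with $k'<k$. -/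

import Mathlib

/-!
A finite directed graph, possibly with loops and parallel edges, is a `Quiver` on a finite vertex
type; the outgoing edges of a vertex `v` form the type `Quiver.Star v`.
-/

namespace RoadColoring

universe u w

/-- Every vertex has exactly `d` outgoing edges. For `d = 0` an infinite set of outgoing edges
would also have `Nat.card` zero; the definition is used with `0 < d` only. -/
def UniformOutdegree (V : Type u) [Quiver.{w} V] (d : ℕ) : Prop :=
  ∀ v : V, Nat.card (Quiver.Star v) = d

/-- A coloring of a graph of uniform outdegree `d` by `d` colors which makes it a (complete)
deterministic automaton: at each vertex every color is carried by exactly one outgoing edge. -/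
def Coloring (V : Type u) [Quiver.{w} V] (d : ℕ) : Type (max u w) :=
  ∀ v : V, Quiver.Star v ≃ Fin d

section Automaton

variable {V : Type u} [Quiver.{w} V] {d : ℕ}

/-- The state reached from `v` along the outgoing edge of color `a`. -/
def Coloring.step (c : Coloring V d) (v : V) (a : Fin d) : V :=
  ((c v).symm a).1

/-- The state `v s` reached from `v` by reading the word `s` from left to right. -/
def Coloring.run (c : Coloring V d) (v : V) (s : List (Fin d)) : V :=
  s.foldl c.step v

/-- The image `Γ s` of the set of all states under the word `s`. -/
def Coloring.image (c : Coloring V d) (s : List (Fin d)) : Set V :=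
  Set.range fun v : V => c.run v s

/-- `s` is a `k`-synchronizing word: it is nonempty, `|Γ s| = k`, and `|Γ t| ≥ k` for
all words `t`. -/
def Coloring.IsKSynchronizingWord (c : Coloring V d) (k : ℕ) (s : List (Fin d)) : Prop :=
  s ≠ [] ∧ (c.image s).ncard = k ∧ ∀ t : List (Fin d), k ≤ (c.image t).ncard

/-- The coloring is `k`-synchronizing: its automaton has a `k`-synchronizing word, and `k` is
minimal, that is, no coloring of the graph has a `k'`-synchronizing word with `k' < k`. -/
def Coloring.IsKSynchronizing (c : Coloring V d) (k : ℕ) : Prop :=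
  (∃ s : List (Fin d), c.IsKSynchronizingWord k s) ∧
    ∀ (c' : Coloring V d) (k' : ℕ) (s' : List (Fin d)), c'.IsKSynchronizingWord k' s' → k ≤ k'

end Automaton

section Components

variable {V : Type u} [Quiver.{w} V]

/-- No edge leaves the strongly connected component `C`. -/
def IsSink (C : Quiver.StronglyConnectedComponent V) : Prop :=
  ∀ (a b : V), (a ⟶ b) → Quiver.StronglyConnectedComponent.mk a = C →
    Quiver.StronglyConnectedComponent.mk b = C

/-- The closed path `p` is a cycle: it has positive length, and it repeats no vertex apart from
returning to its starting point at the end. -/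
def IsCycle {v : V} (p : Quiver.Path v v) : Prop :=
  0 < p.length ∧ p.vertices.tail.Nodup

/-- `g` is the greatest common divisor of the lengths of all cycles in the component `C`. -/
def IsGcdOfCycleLengths (C : Quiver.StronglyConnectedComponent V) (g : ℕ) : Prop :=
  ∀ n : ℕ, n ∣ g ↔ ∀ (v : V) (p : Quiver.Path v v), IsCycle p →
    (∀ x ∈ p.vertices, Quiver.StronglyConnectedComponent.mk x = C) → n ∣ p.length

end Components

end RoadColoring

namespace RoadColoring
open Function

/-! ### Iteration and periodic points of a self-map, and the effect of changing one value. -/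

section Iterates

variable {V : Type*} {α : V → V} {u v p : V}

/-! Lower bound: in a sink component of period `g`, every edge raises the phase in `ZMod g` by one.
Hence under any coloring every image meets each phase of each sink component, and has at least `k`
elements.

Upper bound: color the sink components so that any two states of equal phase in one component can be
merged. Words act injectively on an image of minimal size, so such an image, pushed into the sinks,
holds at most one state per component and phase.

For one component this is Trahtman's argument (`exists_recolor_mergeable`): find a recoloring with
two distinct stable states, divide by stability, recolor the smaller quotient by induction, and
lift. To find a stable pair, view a letter as a selection of one edge per vertex. If all
sufficiently high points of its functional graph hang over a single cycle vertex, there are two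
minimal images that differ in one state each, and these two states are stable
(`exists_stable_of_hasUniqueHighTree`). To reach this situation, take a selection with the most
periodic points and redirect single edges (`update_of_max`). If this never succeeds, either two
vertices send all their edges to one vertex, which makes them a stable pair, or the graph is that of
a permutation, where equal phase forces equality (`exists_hasUniqueHighTree_or`). -/

theorem iterate_mem_periodicPts (h : v ∈ periodicPts α) (n : ℕ) : α^[n] v ∈ periodicPts α := by
  obtain ⟨k, hk, hp⟩ := h
  exact ⟨k, hk, hp.apply_iterate n⟩

theorem iterate_mem_periodicPts_of_le {m n : ℕ} (h : α^[m] v ∈ periodicPts α) (hmn : m ≤ n) :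
    α^[n] v ∈ periodicPts α := by
  obtain ⟨k, rfl⟩ := Nat.exists_eq_add_of_le' hmn
  rw [iterate_add_apply]
  exact iterate_mem_periodicPts h k

theorem exists_iterate_iterate_eq_self (h : v ∈ periodicPts α) (n : ℕ) :
    ∃ m, α^[m] (α^[n] v) = v := by
  obtain ⟨k, hk, hp⟩ := h
  refine ⟨(k - 1) * n, ?_⟩
  rw [← iterate_add_apply]
  have : (k - 1) * n + n = k * n := by
    obtain ⟨j, rfl⟩ := Nat.exists_eq_succ_of_ne_zero hk.ne'
    simp [Nat.succ_mul]
  rw [this]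
  exact hp.mul_const n

theorem mem_periodicPts_of_iterate_eq {m : ℕ} (h : α^[m + 1] v = v) : v ∈ periodicPts α :=
  ⟨m + 1, m.succ_pos, h⟩

theorem exists_forall_iterate_mem_periodicPts [Finite V] (α : V → V) :
    ∃ N, ∀ v, α^[N] v ∈ periodicPts α := by
  have key : ∀ v, ∃ n, α^[n] v ∈ periodicPts α := by
    intro v
    obtain ⟨m, n, hne, h⟩ := Finite.exists_ne_map_eq_of_infinite fun n : ℕ => α^[n] v
    wlog hlt : m < n generalizing m n
    · exact this n m hne.symm h.symm (by omega)
    refine ⟨m, n - m, by omega, ?_⟩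
    change α^[n - m] (α^[m] v) = α^[m] v
    rw [← iterate_add_apply, Nat.sub_add_cancel hlt.le]
    exact h.symm
  choose f hf using key
  obtain ⟨N, hN⟩ := (Set.finite_range f).bddAbove
  exact ⟨N, fun v => iterate_mem_periodicPts_of_le (hf v) (hN ⟨v, rfl⟩)⟩

theorem exists_forall_iterate_eq_self [Finite V] (α : V → V) :
    ∃ N, 0 < N ∧ ∀ v ∈ periodicPts α, α^[N] v = v := by
  have := Fintype.ofFinite V
  have key : ∀ v, ∃ n, 0 < n ∧ (v ∈ periodicPts α → IsPeriodicPt α n v) := by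
    intro v
    by_cases h : v ∈ periodicPts α
    · obtain ⟨n, hn, hp⟩ := h
      exact ⟨n, hn, fun _ => hp⟩
    · exact ⟨1, one_pos, fun h' => absurd h' h⟩
  choose f hf hp using key
  refine ⟨∏ v, f v, Finset.prod_pos fun v _ => hf v, fun v hv => ?_⟩
  exact (hp v hv).trans_dvd (Finset.dvd_prod_of_mem f (Finset.mem_univ v))

theorem iterate_ne_of_notMem (h : v ∈ periodicPts α) (hu : u ∉ periodicPts α) (i : ℕ) :
    α^[i] v ≠ u := fun e => hu (e ▸ iterate_mem_periodicPts h i)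

/-- The first `n` points of an orbit that ends outside the periodic points are distinct. -/
theorem injOn_iterate_of_notMem {n : ℕ} (h : α^[n] v ∉ periodicPts α) :
    Set.InjOn (fun i => α^[i] v) (Set.Iic n) := by
  have key : ∀ i j, i < j → j ≤ n → α^[i] v ≠ α^[j] v := by
    intro i j hij hj e
    apply h
    refine iterate_mem_periodicPts_of_le (m := i) ?_ (by omega)
    refine ⟨j - i, by omega, ?_⟩
    change α^[j - i] (α^[i] v) = α^[i] v
    rw [← iterate_add_apply, Nat.sub_add_cancel hij.le, ← e]
  intro i hi j hj e
  rcases lt_trichotomy i j with hij | hij | hij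
  · exact absurd e (key i j hij hj)
  · exact hij
  · exact absurd e.symm (key j i hij hi)

variable [DecidableEq V]

theorem iterate_update {n : ℕ} (h : ∀ i < n, α^[i] v ≠ u) :
    (update α u p)^[n] v = α^[n] v := by
  induction n with
  | zero => rfl
  | succ n ih =>
    rw [iterate_succ_apply', iterate_succ_apply', ih fun i hi => h i (by omega),
      update_of_ne (h n (by omega))]

theorem iterate_update' {n : ℕ} (h : ∀ i < n, (update α u p)^[i] v ≠ u) :
    (update α u p)^[n] v = α^[n] v := by
  have := iterate_update (α := update α u p) (p := α u) h
  rw [← this]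
  simp

theorem exists_first_hit (h : ∃ i, α^[i] v = u) :
    ∃ j, α^[j] v = u ∧ (∀ i < j, α^[i] v ≠ u) ∧ ∀ i ≤ j, (update α u p)^[i] v = α^[i] v := by
  classical
  refine ⟨Nat.find h, Nat.find_spec h, fun i hi => Nat.find_min h hi, fun i hi => ?_⟩
  exact iterate_update fun k hk => Nat.find_min h (by omega)

theorem mem_periodicPts_update_iff (h : ∀ i, α^[i] v ≠ u) :
    v ∈ periodicPts (update α u p) ↔ v ∈ periodicPts α := by
  refine exists_congr fun n => and_congr_right fun _ => ?_
  rw [IsPeriodicPt, IsFixedPt, iterate_update fun i _ => h i]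
  rfl

theorem periodicPts_subset_update (hu : u ∉ periodicPts α) :
    periodicPts α ⊆ periodicPts (update α u p) := fun _ hv =>
  (mem_periodicPts_update_iff (iterate_ne_of_notMem hv hu)).2 hv

end Iterates

/-! ### Trees hanging on the cycles of a self-map. -/

section Roots

variable {V : Type*} {α : V → V}

/-- The orbit of `v` enters the cycles of `α` at `r`. -/
def IsRoot (α : V → V) (v r : V) : Prop :=
  ∃ n, α^[n] v ∉ periodicPts α ∧ α^[n + 1] v = r ∧ r ∈ periodicPts α

/-- The points at distance more than `L` from the cycles of `α` exist and have a common root. -/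
def HasUniqueHighTree (α : V → V) : Prop :=
  ∃ L r, (∃ v, α^[L] v ∉ periodicPts α) ∧ ∀ v, α^[L] v ∉ periodicPts α → IsRoot α v r

theorem exists_isRoot [Finite V] {v : V} (hv : v ∉ periodicPts α) : ∃ r, IsRoot α v r := by
  classical
  have h : ∃ n, α^[n] v ∈ periodicPts α := by
    obtain ⟨N, hN⟩ := exists_forall_iterate_mem_periodicPts α
    exact ⟨N, hN v⟩
  obtain ⟨n, hn⟩ : ∃ n, Nat.find h = n + 1 :=
    Nat.exists_eq_succ_of_ne_zero fun h0 => hv (by simpa [h0] using Nat.find_spec h)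
  exact ⟨_, n, Nat.find_min h (by omega), rfl, hn ▸ Nat.find_spec h⟩

theorem IsRoot.of_iterate {v r : V} {j : ℕ} (h : IsRoot α (α^[j] v) r) : IsRoot α v r := by
  obtain ⟨n, hn, hr, hp⟩ := h
  refine ⟨n + j, by rwa [iterate_add_apply], ?_, hp⟩
  rwa [add_right_comm, iterate_add_apply]

/-- `M + 1` is the maximal height; points of that height all enter the cycles at step `M + 1`
exactly. -/
theorem HasUniqueHighTree.exists_height [Finite V] (h : HasUniqueHighTree α) :
    ∃ M r, (∃ v, α^[M] v ∉ periodicPts α) ∧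
      ∀ v, α^[M] v ∉ periodicPts α → α^[M + 1] v = r ∧ r ∈ periodicPts α := by
  classical
  obtain ⟨L, r, ⟨v, hv⟩, hr⟩ := h
  have hN := exists_forall_iterate_mem_periodicPts α
  obtain ⟨M, hM⟩ : ∃ M, Nat.find hN = M + 1 :=
    Nat.exists_eq_succ_of_ne_zero fun h0 =>
      hv (iterate_mem_periodicPts_of_le (m := 0) (by simpa [h0] using Nat.find_spec hN v)
        (Nat.zero_le _))
  have hspec : ∀ v, α^[M + 1] v ∈ periodicPts α := hM ▸ Nat.find_spec hN
  have hLM : L ≤ M := by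
    by_contra hlt
    exact hv (iterate_mem_periodicPts_of_le (hspec v) (by omega))
  refine ⟨M, r, by simpa using Nat.find_min hN (m := M) (by omega), fun w hw => ?_⟩
  obtain ⟨n, hn, hn', hp⟩ := hr w fun h => hw (iterate_mem_periodicPts_of_le h hLM)
  have h1 : n ≤ M := by
    by_contra hlt
    exact hn (iterate_mem_periodicPts_of_le (hspec w) (by omega))
  have h2 : M ≤ n := by
    by_contra hlt
    exact hw (iterate_mem_periodicPts_of_le (hn' ▸ hp) (by omega))
  obtain rfl : n = M := le_antisymm h1 h2
  exact ⟨hn', hp⟩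

/-- Redirecting one edge of a permutation creates a single nontrivial tree. -/
theorem hasUniqueHighTree_update_of_bijective [DecidableEq V] [Finite V] (hα : Injective α)
    {p q : V} (hq : q ≠ α p) : HasUniqueHighTree (update α p q) := by
  set β := update α p q with hβ
  have hnot : α p ∉ periodicPts β := by
    rintro ⟨n, hn, h⟩
    obtain ⟨k, rfl⟩ := Nat.exists_eq_succ_of_ne_zero hn.ne'
    have h' : β (β^[k] (α p)) = α p := by
      rw [← iterate_succ_apply' β]; exact h
    by_cases hk : β^[k] (α p) = p
    · rw [hk, hβ, update_self] at h'
      exact hq h'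
    · rw [hβ, update_of_ne hk] at h'
      exact hk (hα h')
  refine ⟨0, q, ⟨α p, hnot⟩, fun v hv => ?_⟩
  -- The root has two preimages under `β`, one on the cycle and one off it. Since `α` is injective,
  -- one of them is `p`, so the root is `q`.
  obtain ⟨r, n, hn, hr, hp⟩ := exists_isRoot (v := v) hv
  obtain ⟨z, hz, hzr⟩ : ∃ z ∈ periodicPts β, β z = r := by
    obtain ⟨k, hk, h⟩ := hp
    obtain ⟨k, rfl⟩ := Nat.exists_eq_succ_of_ne_zero hk.ne'
    refine ⟨β^[k] r, iterate_mem_periodicPts ⟨_, hk, h⟩ k, ?_⟩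
    rw [← iterate_succ_apply' β]; exact h
  have hne : β^[n] v ≠ z := fun e => hn (e ▸ hz)
  have hr' : β (β^[n] v) = r := by rw [← iterate_succ_apply' β, hr]
  have hrq : r = q := by
    by_cases h1 : z = p
    · rw [← hzr, h1, hβ, update_self]
    · by_cases h2 : β^[n] v = p
      · rw [← hr', h2, hβ, update_self]
      · have heq := hr'.trans hzr.symm
        rw [hβ, update_of_ne h1, ← hβ, hβ, update_of_ne h2] at heq
        exact absurd (hα heq) hne
  exact ⟨n, hn, hr.trans hrq, hrq ▸ hp⟩

end Roots

/-! ### Redirecting one edge to a point `p` of maximal height `l + 1`. -/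

section Redirection

variable {V : Type*} [Finite V] [DecidableEq V] {α : V → V} {u p : V} {l : ℕ}

omit [DecidableEq V] in
theorem hasUniqueHighTree_of_hits {x : V} {L : ℕ} (hx : x ∉ periodicPts α)
    (hex : ∃ v, α^[L] v ∉ periodicPts α)
    (hhit : ∀ v, α^[L] v ∉ periodicPts α → ∃ j, α^[j] v = x) : HasUniqueHighTree α := by
  obtain ⟨r, hr⟩ := exists_isRoot hx
  refine ⟨L, r, hex, fun v hv => ?_⟩
  obtain ⟨j, hj⟩ := hhit v hv
  exact IsRoot.of_iterate (j := j) (hj ▸ hr)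

omit [Finite V] in
theorem exists_iterate_update_eq {v : V} {L : ℕ} (h : α^[L] v ∈ periodicPts α)
    (h' : (update α u p)^[L] v ∉ periodicPts (update α u p)) :
    ∃ j, (update α u p)^[j] v = u := by
  by_contra! hne
  have heq : ∀ n, (update α u p)^[n] v = α^[n] v := fun n => iterate_update' fun i _ => hne i
  apply h'
  rw [heq, mem_periodicPts_update_iff]
  · exact h
  · intro i
    rw [← iterate_add_apply, ← heq]
    exact hne _

/-- The vertex `u` now sits above `p`, at height `l + 2`, and every orbit that became too high must
pass through `u`. -/
theorem hasUniqueHighTree_update_of_avoid (hL : ∀ v, α^[l + 1] v ∈ periodicPts α)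
    (hp : α^[l] p ∉ periodicPts α) (hne : ∀ i, α^[i] p ≠ u) :
    HasUniqueHighTree (update α u p) := by
  have heq : ∀ n, (update α u p)^[n + 1] u = α^[n] p := fun n => by
    rw [iterate_succ_apply, update_self, iterate_update fun i _ => hne i]
  refine hasUniqueHighTree_of_hits (x := u) (L := l + 1) ?_ ⟨u, ?_⟩
    fun v hv => exists_iterate_update_eq (hL v) hv
  · rintro ⟨n, hn, h⟩
    obtain ⟨n, rfl⟩ := Nat.exists_eq_succ_of_ne_zero hn.ne'
    exact hne n ((heq n).symm.trans h)
  · rw [heq, mem_periodicPts_update_iff]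
    · exact hp
    · intro i
      rw [← iterate_add_apply]
      exact hne _

/-- The new edge closes the path from `p` to `u` into a cycle; no old cycle is cut because `u` lies
on none. -/
theorem ncard_periodicPts_lt_update (hu : u ∉ periodicPts α) (hhit : ∃ i, α^[i] p = u) :
    (periodicPts α).ncard < (periodicPts (update α u p)).ncard := by
  refine Set.ncard_lt_ncard ⟨periodicPts_subset_update hu, fun hsub => hu (hsub ?_)⟩
  obtain ⟨j, hj, -, heq⟩ := exists_first_hit (p := p) hhit
  refine mem_periodicPts_of_iterate_eq (m := j) ?_
  rw [iterate_succ_apply, update_self, heq j le_rfl, hj]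

/-- Redirecting an edge of the cycle below `p` to `p` replaces the arc of length `t` from `u` to
the root by the path from `p` to the root. -/
theorem update_on_cycle (hL : ∀ v, α^[l + 1] v ∈ periodicPts α)
    (hp : α^[l] p ∉ periodicPts α) (hu : u ∈ periodicPts α) (hhit : ∃ i, α^[i] p = u) :
    ∃ t, α^[t + 1] u = α^[l + 1] p ∧
      (∀ i ≤ t, (update α u p)^[i] (α u) = α^[i + 1] u) ∧
      (∀ i < t, α^[i + 1] u ∉ periodicPts (update α u p)) ∧
      (periodicPts α).ncard + (l + 1) ≤ (periodicPts (update α u p)).ncard + t ∧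
      ∀ v, (update α u p)^[l + 1] v ∉ periodicPts (update α u p) →
        IsRoot (update α u p) v (α^[l + 1] p) := by
  classical
  obtain ⟨j, hj, hjmin, hpath⟩ := exists_first_hit (p := p) hhit
  set β := update α u p with hβ
  set r := α^[l + 1] p with hr
  have hlj : l + 1 ≤ j := by
    by_contra hlt
    exact hp (iterate_mem_periodicPts_of_le (hj ▸ hu) (by omega))
  have hru : α^[j - (l + 1)] r = u := by
    rw [hr, ← iterate_add_apply, Nat.sub_add_cancel hlj, hj]
  have hback : ∀ v ∈ periodicPts α, (∃ n, α^[n] v = u) → ∃ t, α^[t + 1] u = v := by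
    rintro v hv ⟨n, rfl⟩
    obtain ⟨k, hk, hkv⟩ := hv
    obtain ⟨k, rfl⟩ := Nat.exists_eq_succ_of_ne_zero hk.ne'
    obtain ⟨m, hm⟩ := exists_iterate_iterate_eq_self (α := α) ⟨_, hk, hkv⟩ n
    refine ⟨k + m, ?_⟩
    rw [show k + m + 1 = (k + 1) + m by omega, iterate_add_apply, hm]
    exact hkv
  have hex : ∃ t, α^[t + 1] u = r := hback r (hL p) ⟨_, hru⟩
  -- First arrival at `r`: the lost arc consists of `α^[1] u, …, α^[t] u`, while the new cycle runs
  -- from `p` through `r` to `u`.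
  obtain ⟨t, ht, htmin⟩ : ∃ t, α^[t + 1] u = r ∧ ∀ i < t, α^[i + 1] u ≠ r :=
    ⟨Nat.find hex, Nat.find_spec hex, fun i hi => Nat.find_min hex hi⟩
  have hret : ∀ i < t, α^[i + 1] u ≠ u := by
    intro i hi h
    refine htmin (t - i - 1) (by omega) ?_
    rw [← ht, show t + 1 = (t - i - 1 + 1) + (i + 1) by omega, iterate_add_apply _ _ (i + 1), h]
  have harc : ∀ i ≤ t, β^[i] (α u) = α^[i + 1] u := by
    intro i hi
    rw [iterate_succ_apply]
    exact iterate_update fun k hk => by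
      rw [← iterate_succ_apply]
      exact hret k (by omega)
  have hβu : β u = p := update_self ..
  have hpP : p ∈ periodicPts β := by
    refine mem_periodicPts_of_iterate_eq (m := j) ?_
    rw [iterate_succ_apply', hpath j le_rfl, hj, hβu]
  have hSP : ∀ i ≤ j, α^[i] p ∈ periodicPts β := fun i hi =>
    hpath i hi ▸ iterate_mem_periodicPts hpP i
  have hSclosed : ∀ n, ∃ i ≤ j, β^[n] r = α^[i] p := by
    intro n
    induction n with
    | zero => exact ⟨l + 1, hlj, rfl⟩
    | succ n ih =>
      obtain ⟨i, hi, h⟩ := ih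
      rw [iterate_succ_apply', h]
      rcases hi.lt_or_eq with hi' | rfl
      · exact ⟨i + 1, hi', by rw [← hpath i hi, ← hpath (i + 1) hi', iterate_succ_apply']⟩
      · exact ⟨0, Nat.zero_le _, by rw [hj, hβu]; rfl⟩
  have harcS : ∀ i < t, ∀ k ≤ j, α^[i + 1] u ≠ α^[k] p := by
    intro i hi k hk h
    have hlk : l < k := by
      by_contra hlt
      refine hp (iterate_mem_periodicPts_of_le (m := k) ?_ (by omega))
      rw [← h]
      exact iterate_mem_periodicPts hu _
    have h1 : α^[j - k] (α^[i + 1] u) = u := by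
      rw [h, ← iterate_add_apply, Nat.sub_add_cancel hk, hj]
    have h2 : α^[t - i] (α^[i + 1] u) = r := by
      rw [← iterate_add_apply, ← ht]; congr 1; omega
    rcases lt_or_ge (j - k) (t - i) with hlt | hge
    · rw [← iterate_add_apply] at h1
      exact hret (j - k + i) (by omega) h1
    · rw [show j - k = (j - k - (t - i)) + (t - i) by omega, iterate_add_apply, h2, hr,
        ← iterate_add_apply] at h1
      exact hjmin _ (by omega) h1
  have harcP : ∀ i < t, α^[i + 1] u ∉ periodicPts β := by
    intro i hi h
    have h2 : β^[t - i] (α^[i + 1] u) = r := by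
      rw [← harc i hi.le, ← iterate_add_apply, Nat.sub_add_cancel hi.le, harc t le_rfl, ht]
    obtain ⟨m, hm⟩ := exists_iterate_iterate_eq_self h (t - i)
    rw [h2] at hm
    obtain ⟨k, hk, hk'⟩ := hSclosed m
    exact harcS i hi k hk (hm.symm.trans hk')
  have hlost : ∀ v ∈ periodicPts α, v ∉ periodicPts β → ∃ i < t, α^[i + 1] u = v := by
    intro v hv hvβ
    have hvu : ∃ n, α^[n] v = u := by
      by_contra! hne
      exact hvβ ((mem_periodicPts_update_iff hne).2 hv)
    have hex' := hback v hv hvu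
    obtain ⟨m, hm, hmmin⟩ : ∃ m, α^[m + 1] u = v ∧ ∀ i < m, α^[i + 1] u ≠ v :=
      ⟨Nat.find hex', Nat.find_spec hex', fun i hi => Nat.find_min hex' hi⟩
    by_cases hmt : m < t
    · exact ⟨m, hmt, hm⟩
    have hvp : α^[m - t + (l + 1)] p = v := by
      rw [iterate_add_apply, ← hr, ← ht, ← iterate_add_apply, ← hm]; congr 1; omega
    by_cases hmj : m - t + (l + 1) ≤ j
    · exact absurd (hvp ▸ hSP _ hmj) hvβ
    · exfalso
      refine hmmin (m - t + l - j) (by omega) ?_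
      rw [← hvp, ← hj, ← iterate_add_apply]; congr 1; omega
  refine ⟨t, ht, harc, harcP, ?_, fun v hv => ?_⟩
  · have h1 : ((fun i => α^[i] p) '' Set.Iic l) ⊆ periodicPts β \ periodicPts α := by
      rintro _ ⟨i, hi, rfl⟩
      have hi : i ≤ l := hi
      exact ⟨hSP i (by omega), fun h => hp (iterate_mem_periodicPts_of_le h hi)⟩
    have h2 : periodicPts α \ periodicPts β ⊆ (fun i => α^[i + 1] u) '' Set.Iio t := by
      rintro v ⟨hv, hv'⟩
      exact hlost v hv hv'
    have h3 := Set.ncard_le_ncard h1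
    rw [(injOn_iterate_of_notMem hp).ncard_image] at h3
    have h4 := (Set.ncard_le_ncard h2).trans (Set.ncard_image_le (Set.finite_Iio t))
    have h5 := Set.ncard_inter_add_ncard_sdiff_eq_ncard (periodicPts α) (periodicPts β)
    have h6 := Set.ncard_inter_add_ncard_sdiff_eq_ncard (periodicPts β) (periodicPts α)
    rw [Set.inter_comm] at h6
    simp only [← Nat.card_coe_set_eq, Nat.card_eq_fintype_card, Fintype.card_Iic,
      Fintype.card_Iio, Nat.card_Iic, Nat.card_Iio] at h3 h4 h5 h6 ⊢
    omega
  -- A point that is still not periodic after `l + 1` steps has by then landed on the lost arc,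
  -- which now flows into `r`.
  · obtain ⟨k, hk⟩ := exists_iterate_update_eq (hL v) hv
    have huβ : u ∈ periodicPts β := hj ▸ hSP j le_rfl
    have hlk : l + 1 < k := by
      by_contra hlt
      exact hv (iterate_mem_periodicPts_of_le (m := k) (hk ▸ huβ) (by omega))
    have heq : β^[l + 1] v = α^[l + 1] v := iterate_update' fun i hi h =>
      hv (iterate_mem_periodicPts_of_le (m := i) (h ▸ huβ) hi.le)
    obtain ⟨i, hi, h⟩ := hlost (β^[l + 1] v) (heq ▸ hL v) hv
    refine IsRoot.of_iterate (j := l + 1) ?_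
    rw [← h, ← harc i hi.le]
    refine ⟨t - 1 - i, ?_, ?_, hSP _ hlj⟩
    · rw [← iterate_add_apply, Nat.sub_add_cancel (by omega), harc _ (by omega)]
      exact harcP _ (by omega)
    · rw [← iterate_add_apply, show t - 1 - i + 1 + i = t by omega, harc t le_rfl, ht]

/-- What redirecting an edge to a point at maximal height yields when it creates neither more
periodic points nor a unique high tree. -/
theorem update_of_max (hL : ∀ v, α^[l + 1] v ∈ periodicPts α) (hp : α^[l] p ∉ periodicPts α)
    (hmax : (periodicPts (update α u p)).ncard ≤ (periodicPts α).ncard)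
    (hnot : ¬ HasUniqueHighTree (update α u p)) :
    u ∈ periodicPts α ∧ α^[l + 1] (α u) = α^[l + 1] p ∧
      (periodicPts (update α u p)).ncard = (periodicPts α).ncard ∧
      (∀ v, (update α u p)^[l + 1] v ∈ periodicPts (update α u p)) ∧
      (update α u p)^[l] (α u) ∉ periodicPts (update α u p) ∧
      (update α u p)^[l] (α u) = α^[l] (α u) ∧
      (update α u p)^[l + 1] (α u) = α^[l + 1] p := by
  have hhit : ∃ i, α^[i] p = u := by
    by_contra! hne
    exact hnot (hasUniqueHighTree_update_of_avoid hL hp hne)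
  have hu : u ∈ periodicPts α := by
    by_contra hu
    exact absurd (ncard_periodicPts_lt_update hu hhit) (by omega)
  obtain ⟨t, ht, harc, harcP, hcard, hroot⟩ := update_on_cycle hL hp hu hhit
  have hall : ∀ v, (update α u p)^[l + 1] v ∈ periodicPts (update α u p) := by
    by_contra! hex
    exact hnot ⟨_, _, hex, hroot⟩
  -- Maximality gives `l + 1 ≤ t`. The old arc is now a tail of height `t`, and no height exceeds `l
  -- + 1`.
  have htl : t = l + 1 := by
    by_contra hne
    refine harcP (l + 1) (by omega) ?_
    rw [← harc (l + 1) (by omega)]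
    exact hall _
  subst htl
  refine ⟨hu, by rw [← iterate_succ_apply, ht], by omega, hall, ?_, ?_, ?_⟩
  · rw [harc l (by omega)]
    exact harcP l (by omega)
  · rw [harc l (by omega), iterate_succ_apply]
  · rw [harc _ le_rfl, ht]

end Redirection

/-! ### Selections with the most periodic points. -/

section Selections

variable {V : Type*} [Finite V] {E : V → V → Prop}

/-- A choice of one outgoing edge at each vertex. -/
def IsSelection (E : V → V → Prop) (α : V → V) : Prop := ∀ v, E v (α v)

omit [Finite V] in
theorem IsSelection.update [DecidableEq V] {α : V → V} (h : IsSelection E α) {u p : V}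
    (hup : E u p) : IsSelection E (update α u p) := by
  intro v
  by_cases hv : v = u
  · subst hv; simpa using hup
  · simpa [hv] using h v

/-- The selection `α` has as many periodic points as possible. -/
def IsMaxSelection (E : V → V → Prop) (α : V → V) : Prop :=
  IsSelection E α ∧ ∀ β, IsSelection E β → (periodicPts β).ncard ≤ (periodicPts α).ncard

theorem exists_isMaxSelection (hE : ∀ v, ∃ w, E v w) : ∃ α, IsMaxSelection E α := by
  classical
  choose f hf using hE
  have : Nonempty {α // IsSelection E α} := ⟨⟨f, hf⟩⟩
  obtain ⟨α, hα⟩ := Finite.exists_max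
    fun α : {α // IsSelection E α} => (periodicPts α.1).ncard
  exact ⟨α.1, α.2, fun β hβ => hα ⟨β, hβ⟩⟩

variable {α : V → V} {l : ℕ} {p : V}

/-- The vertex below the cycle on a longest path of a maximal selection has a single successor,
unless some selection has a unique high tree. -/
theorem eq_of_isMaxSelection (hpred : ∀ v, ∃ u, E u v)
    (hno : ∀ β, IsSelection E β → ¬ HasUniqueHighTree β) (hα : IsMaxSelection E α)
    (hL : ∀ v, α^[l + 1] v ∈ periodicPts α) (hp : α^[l] p ∉ periodicPts α) {e : V}
    (he : E (α^[l] p) e) : e = α^[l + 1] p := by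
  classical
  by_contra hne
  set b := α^[l] p with hb
  set γ := Function.update α b e with hγ
  have hγE : IsSelection E γ := hα.1.update he
  have hsub : periodicPts α ⊆ periodicPts γ := periodicPts_subset_update hp
  have hPeq : periodicPts α = periodicPts γ :=
    Set.eq_of_subset_of_ncard_le hsub (hα.2 γ hγE)
  have hγp : γ^[l] p = b := iterate_update fun i hi h => by
    have := injOn_iterate_of_notMem hp (show i ∈ Set.Iic l from hi.le)
      (Set.mem_Iic.2 le_rfl) h
    omega
  have hγb : γ b = e := update_self ..
  have hγp' : γ^[l + 1] p = e := by rw [iterate_succ_apply', hγp, hγb]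
  have hbγ : b ∉ periodicPts γ := hPeq ▸ hp
  by_cases heP : e ∈ periodicPts α
  · have hγL : ∀ v, γ^[l + 1] v ∈ periodicPts γ := by
      intro v
      by_cases hhit : ∃ i < l + 1, γ^[i] v = b
      · obtain ⟨i, hi, h⟩ := hhit
        refine iterate_mem_periodicPts_of_le (m := i + 1) ?_ (by omega)
        rw [iterate_succ_apply', h, hγb]
        exact hsub heP
      · push Not at hhit
        rw [iterate_update' hhit]
        exact hsub (hL v)
    obtain ⟨u, hu⟩ := hpred p
    -- Redirecting the same edge at `u` in `α` and in `γ` forces the orbit of `u` to reach the root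
    -- of `p` in both. The two maps agree on the cycles, so the roots `α^[l + 1] p` and `e`
    -- coincide.
    have key : ∀ β, IsSelection E β → (periodicPts β).ncard = (periodicPts α).ncard →
        (∀ v, β^[l + 1] v ∈ periodicPts β) → β^[l] p ∉ periodicPts β →
        u ∈ periodicPts β ∧ β^[l + 1] (β u) = β^[l + 1] p := by
      intro β hβ hc h1 h2
      have := update_of_max (u := u) h1 h2 (hc ▸ hα.2 _ (hβ.update hu)) (hno _ (hβ.update hu))
      exact ⟨this.1, this.2.1⟩
    obtain ⟨huP, h1⟩ := key α hα.1 rfl hL hp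
    obtain ⟨-, h2⟩ := key γ hγE (by rw [hPeq]) hγL (by rwa [hγp])
    rw [← iterate_succ_apply] at h1 h2
    rw [hγp', hγ, iterate_update fun i _ => iterate_ne_of_notMem huP hp i, h1] at h2
    exact hne h2.symm
  -- Otherwise `p` becomes higher than `l + 1`, and every such high point passes through `b`.
  · refine hno γ hγE (hasUniqueHighTree_of_hits (x := b) (L := l + 1) hbγ ⟨p, ?_⟩
      fun v hv => exists_iterate_update_eq (hL v) hv)
    rwa [hγp', ← hPeq]

/-- In a graph without sinks and sources, some selection has a unique high tree, or two vertices
have all their outgoing edges lead to the same vertex, or the graph is that of a permutation. -/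
theorem exists_hasUniqueHighTree_or (hE : ∀ v, ∃ w, E v w) (hpred : ∀ v, ∃ u, E u v) :
    (∃ α, IsSelection E α ∧ HasUniqueHighTree α) ∨
    (∃ b c r, b ≠ c ∧ (∀ e, E b e → e = r) ∧ ∀ e, E c e → e = r) ∨
    ∃ α : V → V, Injective α ∧ ∀ v e, E v e → e = α v := by
  classical
  by_cases hgood : ∃ α, IsSelection E α ∧ HasUniqueHighTree α
  · exact Or.inl hgood
  have hno : ∀ β, IsSelection E β → ¬ HasUniqueHighTree β := fun β hβ h => hgood ⟨β, hβ, h⟩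
  right
  obtain ⟨α, hα⟩ := exists_isMaxSelection hE
  have hN := exists_forall_iterate_mem_periodicPts α
  rcases Nat.eq_zero_or_pos (Nat.find hN) with h0 | hpos
  · right
    have hall : ∀ v, v ∈ periodicPts α := by simpa [h0] using Nat.find_spec hN
    have hinj : Injective α := by
      rw [Finite.injective_iff_surjective]
      intro v
      obtain ⟨k, hk, h⟩ := hall v
      obtain ⟨k, rfl⟩ := Nat.exists_eq_succ_of_ne_zero hk.ne'
      exact ⟨α^[k] v, by rw [← iterate_succ_apply' α]; exact h⟩
    refine ⟨α, hinj, fun v e he => ?_⟩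
    by_contra hne
    exact hno _ (hα.1.update he) (hasUniqueHighTree_update_of_bijective hinj hne)
  · left
    obtain ⟨l, hl⟩ := Nat.exists_eq_succ_of_ne_zero hpos.ne'
    have hL : ∀ v, α^[l + 1] v ∈ periodicPts α := by
      have := Nat.find_spec hN
      rwa [hl] at this
    have hp : ∃ p, α^[l] p ∉ periodicPts α := by
      simpa using Nat.find_min hN (m := l) (by omega)
    obtain ⟨p, hp⟩ := hp
    obtain ⟨u, hu⟩ := hpred p
    have hβ := hα.1.update hu
    obtain ⟨huP, -, hcard, hL', hp', hc, hr⟩ :=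
      update_of_max hL hp (hα.2 _ hβ) (hno _ hβ)
    -- Redirecting `u` to `p` gives a second maximal selection, with `α u` at maximal height over
    -- the same root. The last vertices before the root differ: one is off the cycles of `α`, the
    -- other on them.
    refine ⟨α^[l] p, α^[l] (α u), α^[l + 1] p, ?_,
      fun e he => eq_of_isMaxSelection hpred hno hα hL hp he, fun e he => ?_⟩
    · intro h
      refine hp (h ▸ ?_)
      rw [← iterate_succ_apply]
      exact iterate_mem_periodicPts huP _
    · rw [← hr]
      refine eq_of_isMaxSelection hpred hno ⟨hβ, fun γ hγ => hcard ▸ hα.2 γ hγ⟩ hL' hp' ?_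
      rwa [hc]

end Selections

/-! ### Automata, minimal images and stable pairs. -/

section Words

variable {V A : Type*} {δ : V → A → V}

/-- The state reached from `v` by reading the word `s` in the automaton `δ`. -/
def runWord (δ : V → A → V) (v : V) (s : List A) : V := s.foldl δ v

@[simp] theorem runWord_nil (v : V) : runWord δ v [] = v := rfl

@[simp] theorem runWord_cons (v : V) (a : A) (s : List A) :
    runWord δ v (a :: s) = runWord δ (δ v a) s := rfl

theorem runWord_append (v : V) (s t : List A) :
    runWord δ v (s ++ t) = runWord δ (runWord δ v s) t := List.foldl_append ..

theorem runWord_replicate (v : V) (a : A) (n : ℕ) :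
    runWord δ v (List.replicate n a) = (fun w => δ w a)^[n] v := by
  induction n generalizing v with
  | zero => rfl
  | succ n ih => rw [List.replicate_succ, runWord_cons, ih]; rfl

/-- Some word sends `u` and `v` to the same state. -/
def Mergeable (δ : V → A → V) (u v : V) : Prop := ∃ s, runWord δ u s = runWord δ v s

/-- The pair `u`, `v` stays mergeable after reading any word. -/
def Stable (δ : V → A → V) (u v : V) : Prop :=
  ∀ s, Mergeable δ (runWord δ u s) (runWord δ v s)

/-- The underlying graph of `δ` is strongly connected. -/
def IsTransitive (δ : V → A → V) : Prop := ∀ u v, ∃ s, runWord δ u s = v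

/-- Paths of some common length lead from `u` and `v` to the same state. -/
def SamePhase (δ : V → A → V) (u v : V) : Prop :=
  ∃ s t : List A, s.length = t.length ∧ runWord δ u s = runWord δ v t

/-- The automaton `δ` with its letters permuted at each state. -/
def recolor (δ : V → A → V) (σ : V → Equiv.Perm A) : V → A → V := fun v a => δ v (σ v a)

theorem exists_runWord_recolor (σ : V → Equiv.Perm A) (v : V) (s : List A) :
    ∃ t : List A, t.length = s.length ∧ runWord (recolor δ σ) v t = runWord δ v s := by
  induction s generalizing v with
  | nil => exact ⟨[], rfl, rfl⟩
  | cons a s ih =>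
    obtain ⟨t, ht, h⟩ := ih (δ v a)
    refine ⟨(σ v).symm a :: t, by simp [ht], ?_⟩
    simpa [recolor] using h

theorem IsTransitive.recolor (h : IsTransitive δ) (σ : V → Equiv.Perm A) :
    IsTransitive (recolor δ σ) := by
  intro u v
  obtain ⟨s, hs⟩ := h u v
  obtain ⟨t, -, ht⟩ := exists_runWord_recolor (δ := δ) σ u s
  exact ⟨t, ht.trans hs⟩

theorem SamePhase.recolor {u v : V} (h : SamePhase δ u v) (σ : V → Equiv.Perm A) :
    SamePhase (recolor δ σ) u v := by
  obtain ⟨s, t, hst, h⟩ := h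
  obtain ⟨s', hs, hs'⟩ := exists_runWord_recolor (δ := δ) σ u s
  obtain ⟨t', ht, ht'⟩ := exists_runWord_recolor (δ := δ) σ v t
  exact ⟨s', t', by omega, by rw [hs', ht', h]⟩

theorem Stable.step {u v : V} (h : Stable δ u v) (a : A) : Stable δ (δ u a) (δ v a) :=
  fun s => h (a :: s)

/-- Stability is an equivalence relation. -/
abbrev stableSetoid (δ : V → A → V) : Setoid V where
  r := Stable δ
  iseqv :=
    { refl := fun _ _ => ⟨[], rfl⟩
      symm := fun h s => (h s).imp fun _ ht => ht.symm
      trans := by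
        intro u v w huv hvw s
        obtain ⟨t, ht⟩ := huv s
        obtain ⟨t', ht'⟩ := hvw (s ++ t)
        refine ⟨t ++ t', ?_⟩
        rw [runWord_append, runWord_append, ht, ← runWord_append _ s, ht', runWord_append,
          ← runWord_append _ t, runWord_append] }

/-- The word `w` has an image of minimal cardinality. -/
def IsMinimalWord (δ : V → A → V) (w : List A) : Prop :=
  ∀ t, (Set.range fun v => runWord δ v w).ncard ≤ (Set.range fun v => runWord δ v t).ncard

theorem exists_isMinimalWord (δ : V → A → V) : ∃ w, IsMinimalWord δ w :=
  ⟨argmin fun w => (Set.range fun v => runWord δ v w).ncard, fun t =>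
    argmin_le (fun w => (Set.range fun v => runWord δ v w).ncard) t⟩

theorem image_range_runWord (w s : List A) :
    (fun v => runWord δ v s) '' (Set.range fun v => runWord δ v w) =
      Set.range fun v => runWord δ v (w ++ s) := by
  rw [← Set.range_comp]
  congr 1
  funext v
  exact (runWord_append v w s).symm

theorem IsMinimalWord.ncard_eq {w s : List A} (hw : IsMinimalWord δ w) (hs : IsMinimalWord δ s) :
    (Set.range fun v => runWord δ v w).ncard = (Set.range fun v => runWord δ v s).ncard :=
  le_antisymm (hw s) (hs w)

variable [Finite V]

theorem IsMinimalWord.append {w : List A} (hw : IsMinimalWord δ w) (s : List A) :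
    IsMinimalWord δ (w ++ s) := by
  intro t
  rw [← image_range_runWord]
  exact (Set.ncard_image_le).trans (hw t)

theorem IsMinimalWord.append_left {w : List A} (hw : IsMinimalWord δ w) (s : List A) :
    IsMinimalWord δ (s ++ w) := by
  intro t
  refine (Set.ncard_le_ncard ?_).trans (hw t)
  rintro _ ⟨v, rfl⟩
  exact ⟨runWord δ v s, (runWord_append ..).symm⟩

/-- A further word cannot shrink a minimal image, so it identifies no two of its points. -/
theorem IsMinimalWord.injOn {w : List A} (hw : IsMinimalWord δ w) (s : List A) :
    Set.InjOn (fun v => runWord δ v s) (Set.range fun v => runWord δ v w) := by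
  refine Set.injOn_of_ncard_image_eq ?_
  rw [image_range_runWord]
  exact (hw.append s).ncard_eq hw

/-- States are brought into `S` one at a time; those already there stay. -/
theorem exists_word_forall_mem {S : Set V}
    (hS : ∀ v ∈ S, ∀ s, runWord δ v s ∈ S) (h : ∀ v, ∃ s, runWord δ v s ∈ S) :
    ∃ s, ∀ v, runWord δ v s ∈ S := by
  classical
  have := Fintype.ofFinite V
  suffices ∀ T : Finset V, ∃ s, ∀ v ∈ T, runWord δ v s ∈ S by
    obtain ⟨s, hs⟩ := this Finset.univ
    exact ⟨s, fun v => hs v (Finset.mem_univ v)⟩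
  intro T
  induction T using Finset.induction_on with
  | empty => exact ⟨[], by simp⟩
  | insert x T _ ih =>
    obtain ⟨s, hs⟩ := ih
    obtain ⟨t, ht⟩ := h (runWord δ x s)
    refine ⟨s ++ t, fun v hv => ?_⟩
    rw [runWord_append]
    rcases Finset.mem_insert.1 hv with rfl | hv
    · exact ht
    · exact hS _ (hs v hv) t

/-- Push a minimal image containing a highest point by `a^M`. Only `q` can be off the cycles, since
two such points would collide at the common root. A further power of `a` fixes the cycles and moves
`q` to `q'`. If after some `s` the pair could not merge, `s ++ w` would be injective on `insert q'
F`, which exceeds the minimal size. -/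
theorem exists_stable_of_hasUniqueHighTree (hδ : IsTransitive δ) (a : A)
    (h : HasUniqueHighTree fun v => δ v a) : ∃ u v, u ≠ v ∧ Stable δ u v := by
  set α : V → V := fun v => δ v a with hα
  obtain ⟨M, r, ⟨v₀, hv₀⟩, hr⟩ := h.exists_height
  obtain ⟨N, hN, hfix⟩ := exists_forall_iterate_eq_self α
  have hNall : ∃ K, ∀ v, α^[K * N] v ∈ periodicPts α := by
    obtain ⟨K, hK⟩ := exists_forall_iterate_mem_periodicPts α
    exact ⟨K, fun v => iterate_mem_periodicPts_of_le (hK v) (Nat.le_mul_of_pos_right K hN)⟩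
  obtain ⟨K, hK⟩ := hNall
  have hfixK : ∀ v ∈ periodicPts α, α^[K * N] v = v := by
    intro v hv
    rw [mul_comm]
    exact IsPeriodicPt.mul_const (show IsPeriodicPt α N v from hfix v hv) K
  -- a minimal image containing `v₀`, then pushed along `a`
  obtain ⟨w, hw⟩ := exists_isMinimalWord δ
  obtain ⟨t, ht⟩ := hδ (runWord δ v₀ w) v₀
  have hw' := hw.append t
  have hv₀mem : v₀ ∈ Set.range fun v => runWord δ v (w ++ t) :=
    ⟨v₀, by simp only [runWord_append, ht]⟩
  set F := Set.range fun v => runWord δ v ((w ++ t) ++ List.replicate M a) with hF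
  have hw₁ := hw'.append (List.replicate M a)
  have hw₂ := hw₁.append (List.replicate (K * N) a)
  set q := α^[M] v₀ with hq
  have hqF : q ∈ F := by
    rw [hF, ← image_range_runWord]
    exact ⟨v₀, hv₀mem, by simp only [runWord_replicate]; rfl⟩
  have hFper : ∀ x ∈ F, x ≠ q → x ∈ periodicPts α := by
    intro x hx hxq
    rw [hF, ← image_range_runWord] at hx
    obtain ⟨y, hy, rfl⟩ := hx
    by_contra hper
    simp only [runWord_replicate] at hper hxq
    have h1 := (hr y hper).1
    have h2 := (hr v₀ hv₀).1
    have : y = v₀ := hw'.injOn (List.replicate (M + 1) a) hy hv₀mem (by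
      simp only [runWord_replicate]
      exact h1.trans h2.symm)
    exact hxq (this ▸ rfl)
  set q' := α^[K * N] q with hq'
  have hq'per : q' ∈ periodicPts α := hK q
  have hqq' : q ≠ q' := fun e => hv₀ (e ▸ hq'per)
  set G := Set.range fun v => runWord δ v
    (((w ++ t) ++ List.replicate M a) ++ List.replicate (K * N) a) with hG
  have hGimg : G = (fun v => α^[K * N] v) '' F := by
    rw [hG, ← image_range_runWord]
    simp only [runWord_replicate]
    rfl
  have hq'G : q' ∈ G := hGimg ▸ ⟨q, hqF, rfl⟩
  have hFG : ∀ x ∈ F, x ≠ q → x ∈ G := fun x hx hxq =>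
    hGimg ▸ ⟨x, hx, hfixK x (hFper x hx hxq)⟩
  have hq'F : q' ∉ F := by
    intro hmem
    refine hqq' (hw₁.injOn (List.replicate (K * N) a) hqF hmem ?_)
    simp only [runWord_replicate]
    exact (hfixK q' hq'per).symm
  refine ⟨q, q', hqq', fun s => ?_⟩
  by_contra hdead
  have hinj : Set.InjOn (fun v => runWord δ v (s ++ w)) (insert q' F) := by
    have hcross : ∀ x ∈ F, runWord δ x (s ++ w) = runWord δ q' (s ++ w) → False := by
      intro x hx he
      by_cases hxq : x = q
      · subst hxq
        exact hdead ⟨w, by rwa [runWord_append, runWord_append] at he⟩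
      · exact hq'F (hw₂.injOn (s ++ w) (hFG x hx hxq) hq'G he ▸ hx)
    intro x hx y hy hxy
    rcases Set.mem_insert_iff.1 hx with rfl | hx <;> rcases Set.mem_insert_iff.1 hy with rfl | hy
    · rfl
    · exact (hcross y hy hxy.symm).elim
    · exact (hcross x hx hxy).elim
    · exact hw₁.injOn (s ++ w) hx hy hxy
  have h1 := hinj.ncard_image
  rw [Set.ncard_insert_of_notMem hq'F] at h1
  have h2 : ((fun v => runWord δ v (s ++ w)) '' insert q' F).ncard ≤
      (Set.range fun v => runWord δ v (s ++ w)).ncard :=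
    Set.ncard_le_ncard (Set.image_subset_range _ _)
  rw [(hw.append_left s).ncard_eq hw₁, ← hF] at h2
  omega

theorem exists_stable_recolor [Nonempty A] (hδ : IsTransitive δ) {u v : V} (huv : u ≠ v)
    (hph : SamePhase δ u v) :
    ∃ σ : V → Equiv.Perm A, ∃ x y, x ≠ y ∧ Stable (recolor δ σ) x y := by
  classical
  obtain ⟨a⟩ := ‹Nonempty A›
  have hpred : ∀ v, ∃ u, ∃ a, δ u a = v := by
    intro v
    obtain ⟨s, hs⟩ := hδ (δ v a) v
    rcases List.eq_nil_or_concat s with rfl | ⟨s, b, rfl⟩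
    · exact ⟨v, a, hs⟩
    · refine ⟨runWord δ (δ v a) s, b, ?_⟩
      rwa [List.concat_eq_append, runWord_append] at hs
  rcases exists_hasUniqueHighTree_or (E := fun u v => ∃ a, δ u a = v)
    (fun v => ⟨_, a, rfl⟩) hpred with ⟨α, hα, hgood⟩ | ⟨b, c, r, hbc, hb, hc⟩ | ⟨α, hinj, hα⟩
  · choose f hf using hα
    -- The swap makes the letter `a` follow the selection `α`.
    refine ⟨fun v => Equiv.swap a (f v),
      exists_stable_of_hasUniqueHighTree (hδ.recolor _) a ?_⟩
    have : (fun v => recolor δ (fun v => Equiv.swap a (f v)) v a) = α := by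
      funext v
      simp [recolor, hf]
    rwa [this]
  · refine ⟨fun _ => 1, b, c, hbc, fun s => ?_⟩
    have h1 : ∀ x, recolor δ (fun _ => 1) b x = r := fun x => hb _ ⟨x, rfl⟩
    have h2 : ∀ x, recolor δ (fun _ => 1) c x = r := fun x => hc _ ⟨x, rfl⟩
    cases s with
    | nil => exact ⟨[a], by simp [h1, h2]⟩
    | cons x s => exact ⟨[], by simp [h1, h2]⟩
  · exfalso
    have hrun : ∀ (s : List A) x, runWord δ x s = α^[s.length] x := by
      intro s
      induction s with
      | nil => intro x; rfl
      | cons y s ih => intro x; rw [runWord_cons, ih, hα x _ ⟨y, rfl⟩]; rfl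
    obtain ⟨s, t, hst, h⟩ := hph
    rw [hrun, hrun, hst] at h
    exact huv (hinj.iterate _ h)

end Words

/-! ### Induction through the quotient by stability. -/

section Quotient

universe u

variable {A : Type*}

/-- The automaton induced on the classes of stable pairs. -/
def quotientStep {V : Type u} (δ : V → A → V) (x : Quotient (stableSetoid δ)) (a : A) :
    Quotient (stableSetoid δ) :=
  Quotient.map (fun v => δ v a) (fun _ _ h => Stable.step h a) x

theorem mk_runWord_recolor {V : Type u} (δ : V → A → V)
    (σ : Quotient (stableSetoid δ) → Equiv.Perm A) (v : V) (s : List A) :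
    (Quotient.mk (stableSetoid δ) (runWord (recolor δ fun v => σ (Quotient.mk _ v)) v s)) =
      runWord (recolor (quotientStep δ) σ) (Quotient.mk _ v) s := by
  induction s generalizing v with
  | nil => rfl
  | cons a s ih => exact ih _

theorem mk_runWord {V : Type u} (δ : V → A → V) (v : V) (s : List A) :
    (Quotient.mk (stableSetoid δ) (runWord δ v s)) =
      runWord (quotientStep δ) (Quotient.mk _ v) s :=
  mk_runWord_recolor δ (fun _ => 1) v s

/-- A stable pair stays mergeable in a recoloring that is constant on the stability classes. -/
theorem mergeable_recolor_of_stable {V : Type u} {δ : V → A → V}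
    (σ : Quotient (stableSetoid δ) → Equiv.Perm A) {u v : V} (h : Stable δ u v) :
    Mergeable (recolor δ fun v => σ (Quotient.mk _ v)) u v := by
  obtain ⟨s, hs⟩ := h []
  simp only [runWord_nil] at hs
  induction s generalizing u v with
  | nil => exact ⟨[], hs⟩
  | cons a s ih =>
    obtain ⟨t, ht⟩ := ih (h.step a) hs
    have hq : Quotient.mk (stableSetoid δ) u = Quotient.mk _ v := Quotient.sound h
    -- Both states lie in one class, so a single relabelled letter imitates `a` at both.
    refine ⟨(σ (Quotient.mk _ v)).symm a :: t, ?_⟩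
    simpa [recolor, hq] using ht

/-- Road coloring theorem: a strongly connected finite graph has a coloring in which any two
states of the same phase can be merged. -/
theorem exists_recolor_mergeable [Nonempty A] {V : Type u} [Finite V] (δ : V → A → V)
    (hδ : IsTransitive δ) :
    ∃ σ : V → Equiv.Perm A, ∀ u v, SamePhase δ u v → Mergeable (recolor δ σ) u v := by
  induction hn : Nat.card V using Nat.strong_induction_on generalizing V with
  | _ n ih =>
    by_cases htriv : ∀ u v, SamePhase δ u v → u = v
    · exact ⟨fun _ => 1, fun u v h => ⟨[], htriv u v h⟩⟩
    push Not at htriv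
    obtain ⟨u, v, hph, huv⟩ := htriv
    obtain ⟨σ, x, y, hxy, hst⟩ := exists_stable_recolor hδ huv hph
    set ε := recolor δ σ with hε
    have hcard : Nat.card (Quotient (stableSetoid ε)) < n := by
      subst hn
      refine lt_of_le_of_ne (Nat.card_le_card_of_surjective _ Quotient.mk_surjective) ?_
      intro he
      have hbij := (Nat.bijective_iff_surjective_and_card _).2
        ⟨Quotient.mk_surjective (s := stableSetoid ε), he.symm⟩
      exact hxy (hbij.1 (Quotient.sound hst))
    have hq : IsTransitive (quotientStep ε) := by
      intro a b
      induction a using Quotient.inductionOn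
      induction b using Quotient.inductionOn
      rename_i a b
      obtain ⟨s, hs⟩ := hδ.recolor σ a b
      exact ⟨s, by rw [← mk_runWord, hs]⟩
    obtain ⟨τ, hτ⟩ := ih _ hcard (quotientStep ε) hq rfl
    refine ⟨fun v => σ v * τ (Quotient.mk _ v), fun u v hph => ?_⟩
    change Mergeable (recolor ε fun v => τ (Quotient.mk _ v)) u v
    have hphq : SamePhase (quotientStep ε) (Quotient.mk _ u) (Quotient.mk _ v) := by
      obtain ⟨s, t, hst, h⟩ := hph.recolor σ
      exact ⟨s, t, hst, by rw [← mk_runWord, ← mk_runWord, h]⟩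
    obtain ⟨s, hs⟩ := hτ _ _ hphq
    rw [← mk_runWord_recolor, ← mk_runWord_recolor] at hs
    obtain ⟨t, ht⟩ := mergeable_recolor_of_stable τ (Quotient.exact hs)
    exact ⟨s ++ t, by rw [runWord_append, runWord_append, ht]⟩

end Quotient
open Quiver

/-! ### Cycle lengths and phases in a component. -/

section Period

variable {V : Type*} [Quiver V]

theorem exists_eq_comp_of_mem_tail_vertices {a b x : V} (p : Path a b)
    (hx : x ∈ p.vertices.tail) :
    ∃ (p₁ : Path a x) (p₂ : Path x b), p = p₁.comp p₂ ∧ 0 < p₁.length := by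
  obtain ⟨n, hn, rfl⟩ := List.mem_iff_getElem.1 hx
  rw [List.length_tail] at hn
  obtain ⟨v, p₁, p₂, hp, hlen, hv⟩ :=
    p.exists_eq_comp_and_length_eq_of_lt_length (n + 1) (by omega)
  rw [List.getElem_tail]
  subst hv
  exact ⟨p₁, p₂, hp, by omega⟩

/-- Cuts out a closed subpath. Positivity of both lengths makes `c` and `p₁.comp p₂` strictly
shorter than `p`, as induction on length needs. -/
theorem exists_closed_of_not_nodup {a b : V} (p : Path a b) (h : ¬ p.vertices.tail.Nodup) :
    ∃ (x : V) (p₁ : Path a x) (c : Path x x) (p₂ : Path x b),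
      p = p₁.comp (c.comp p₂) ∧ 0 < p₁.length ∧ 0 < c.length := by
  induction p with
  | nil => simp at h
  | @cons y z p e ih =>
    rw [Path.vertices_cons, List.concat_eq_append,
      List.tail_append_of_ne_nil (Path.vertices_ne_nil p)] at h
    by_cases hp : p.vertices.tail.Nodup
    · have hz : z ∈ p.vertices.tail := by
        by_contra hz
        refine h (List.nodup_append.2 ⟨hp, List.nodup_singleton _, ?_⟩)
        intro x hx y hy
        rw [List.mem_singleton] at hy
        rintro rfl
        exact hz (hy ▸ hx)
      obtain ⟨p₁, p₂, rfl, hlen⟩ := exists_eq_comp_of_mem_tail_vertices p hz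
      exact ⟨z, p₁, p₂.cons e, Path.nil, by simp, hlen, by simp⟩
    · obtain ⟨x, p₁, c, p₂, rfl, h1, h2⟩ := ih hp
      exact ⟨x, p₁, c, p₂.cons e, by simp, h1, h2⟩

theorem mk_eq_of_mem_closed {v x : V} (p : Path v v) (hx : x ∈ p.vertices) :
    StronglyConnectedComponent.mk x = StronglyConnectedComponent.mk v := by
  obtain ⟨p₁, p₂, -⟩ := p.exists_eq_comp_of_mem_vertices hx
  exact StronglyConnectedComponent.mk_eq_mk.2 ⟨⟨p₂⟩, ⟨p₁⟩⟩

variable {C : StronglyConnectedComponent V} {g : ℕ}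

theorem IsGcdOfCycleLengths.dvd_length (hg : IsGcdOfCycleLengths C g) {v : V}
    (hv : StronglyConnectedComponent.mk v = C) (p : Path v v) : g ∣ p.length := by
  induction hn : p.length using Nat.strong_induction_on generalizing v with
  | _ n ih =>
    rcases Nat.eq_zero_or_pos n with rfl | hpos
    · exact dvd_zero g
    by_cases hnd : p.vertices.tail.Nodup
    · rw [← hn]
      exact (hg g).1 dvd_rfl v p ⟨hn ▸ hpos, hnd⟩ fun x hx => (mk_eq_of_mem_closed p hx).trans hv
    · obtain ⟨x, p₁, c, p₂, hp, h1, h2⟩ := exists_closed_of_not_nodup p hnd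
      have hlen : p.length = c.length + (p₁.comp p₂).length := by
        rw [hp]
        simp only [Path.length_comp]
        omega
      have hx : StronglyConnectedComponent.mk x = C :=
        (StronglyConnectedComponent.mk_eq_mk.2 ⟨⟨c.comp p₂⟩, ⟨p₁⟩⟩).trans hv
      have hlen' := Path.length_comp p₁ p₂
      rw [← hn, hlen]
      exact dvd_add (ih _ (by omega) hx c rfl) (ih _ (by omega) hv (p₁.comp p₂) rfl)

/-- Any cycle of the component can be inserted as a detour into a closed path at `v`; compare the
lengths with and without it. -/
theorem IsGcdOfCycleLengths.dvd_of_forall_closed (hg : IsGcdOfCycleLengths C g) {v : V}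
    (hv : StronglyConnectedComponent.mk v = C) {n : ℕ} (h : ∀ p : Path v v, n ∣ p.length) :
    n ∣ g := by
  rw [hg n]
  intro w p _ hp
  have hw : StronglyConnectedComponent.mk v = StronglyConnectedComponent.mk w :=
    hv.trans (hp w (Path.start_mem_vertices p)).symm
  obtain ⟨⟨q⟩, ⟨r⟩⟩ := StronglyConnectedComponent.mk_eq_mk.1 hw
  have h1 := h (q.comp r)
  have h2 := h (q.comp (p.comp r))
  simp only [Path.length_comp] at h1 h2
  rw [show q.length + (p.length + r.length) = (q.length + r.length) + p.length by omega] at h2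
  exact (Nat.dvd_add_right h1).1 h2

/-- The lengths of the closed paths at a vertex. -/
def closedLengths (v : V) : AddSubmonoid ℕ where
  carrier := {n | ∃ p : Path v v, p.length = n}
  zero_mem' := ⟨Path.nil, rfl⟩
  add_mem' := by
    rintro _ _ ⟨p, rfl⟩ ⟨q, rfl⟩
    exact ⟨p.comp q, Path.length_comp p q⟩

/-- A submonoid of `ℕ` contains all large multiples of its gcd. -/
theorem IsGcdOfCycleLengths.exists_closed_of_ge (hg : IsGcdOfCycleLengths C g) {v : V}
    (hv : StronglyConnectedComponent.mk v = C) :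
    ∃ n, ∀ m ≥ n, g ∣ m → ∃ p : Path v v, p.length = m := by
  obtain ⟨n, hn⟩ := Nat.exists_mem_closure_of_ge (closedLengths v : Set ℕ)
  refine ⟨n, fun m hm hdvd => ?_⟩
  have hgcd : Nat.setGcd (closedLengths v : Set ℕ) ∣ g :=
    hg.dvd_of_forall_closed hv fun p => Nat.setGcd_dvd_of_mem ⟨p, rfl⟩
  have := hn m hm (hgcd.trans hdvd)
  rwa [AddSubmonoid.closure_eq] at this

/-- The phases of the vertices of a strongly connected component of period `g`. -/
theorem IsGcdOfCycleLengths.exists_phase (hg : IsGcdOfCycleLengths C g) (hpos : 0 < g) :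
    ∃ φ : V → ZMod g,
      (∀ a b : V, (a ⟶ b) → StronglyConnectedComponent.mk a = C →
        StronglyConnectedComponent.mk b = C → φ b = φ a + 1) ∧
      ∀ u v : V, StronglyConnectedComponent.mk u = C → StronglyConnectedComponent.mk v = C →
        φ u = φ v → ∃ (x : V) (p : Path u x) (q : Path v x), p.length = q.length := by
  classical
  obtain ⟨v₀, hv₀⟩ : ∃ v₀, StronglyConnectedComponent.mk v₀ = C := Quotient.mk_surjective C
  have hreach : ∀ v, StronglyConnectedComponent.mk v = C →
      Nonempty (Path v₀ v) ∧ Nonempty (Path v v₀) := fun v hv =>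
    StronglyConnectedComponent.mk_eq_mk.1 (hv₀.trans hv.symm)
  let φ : V → ZMod g := fun v =>
    if h : StronglyConnectedComponent.mk v = C then ((hreach v h).1.some.length : ZMod g) else 0
  -- The length modulo `g` does not depend on the path: close both paths by the same return path.
  have hφ : ∀ v (p : Path v₀ v), StronglyConnectedComponent.mk v = C →
      φ v = (p.length : ZMod g) := by
    intro v p hv
    simp only [φ, dif_pos hv]
    set p' := (hreach v hv).1.some
    obtain ⟨r⟩ := (hreach v hv).2
    have h1 := hg.dvd_length hv₀ (p.comp r)
    have h2 := hg.dvd_length hv₀ (p'.comp r)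
    rw [Path.length_comp, ← ZMod.natCast_eq_zero_iff] at h1 h2
    push_cast at h1 h2
    exact add_right_cancel (h2.trans h1.symm)
  refine ⟨φ, fun a b e ha hb => ?_, fun u v hu hv huv => ?_⟩
  · obtain ⟨p⟩ := (hreach a ha).1
    rw [hφ a p ha, hφ b (p.cons e) hb]
    simp
  · obtain ⟨p⟩ := (hreach u hu).1
    obtain ⟨q⟩ : Nonempty (Path u v) :=
      (StronglyConnectedComponent.mk_eq_mk.1 (hu.trans hv.symm)).1
    have hq : g ∣ q.length := by
      rw [hφ u p hu, hφ v (p.comp q) hv, Path.length_comp] at huv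
      rw [← ZMod.natCast_eq_zero_iff]
      push_cast at huv
      exact left_eq_add.1 huv
    -- Long closed paths at `v` absorb the length of `q`.
    obtain ⟨n, hn⟩ := hg.exists_closed_of_ge hv
    have hge : n ≤ n * g := Nat.le_mul_of_pos_right n hpos
    obtain ⟨c, hc⟩ := hn (n * g) hge (dvd_mul_left g n)
    obtain ⟨c', hc'⟩ := hn (q.length + n * g) (by omega) (dvd_add hq (dvd_mul_left g n))
    exact ⟨v, q.comp c, c', by rw [Path.length_comp, hc, hc']⟩

end Period

/-! ### From components to colorings of the whole graph. -/

section Colorings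

variable {V : Type*} [Quiver V] {d : ℕ}

theorem exists_coloring (hd : 0 < d) (hV : UniformOutdegree V d) : Nonempty (Coloring V d) := by
  refine ⟨fun v => ?_⟩
  have : Finite (Star v) := Nat.finite_of_card_ne_zero (by rw [hV v]; exact hd.ne')
  exact Finite.equivFinOfCardEq (hV v)

variable (c : Coloring V d)

theorem Coloring.exists_word_of_path {u v : V} (p : Path u v) :
    ∃ s : List (Fin d), s.length = p.length ∧ runWord c.step u s = v := by
  induction p with
  | nil => exact ⟨[], rfl, rfl⟩
  | @cons x y p e ih =>
    obtain ⟨s, hs, h⟩ := ih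
    refine ⟨s ++ [c x ⟨y, e⟩], by simp [hs], ?_⟩
    rw [runWord_append, h]
    simp [Coloring.step]

/-- The edge followed when reading a letter. -/
def Coloring.stepHom (v : V) (a : Fin d) : v ⟶ c.step v a := ((c v).symm a).2

variable {c}

theorem IsSink.mk_step {C : StronglyConnectedComponent V} (hC : IsSink C) {v : V}
    (hv : StronglyConnectedComponent.mk v = C) (a : Fin d) :
    StronglyConnectedComponent.mk (c.step v a) = C := hC _ _ (c.stepHom v a) hv

theorem IsSink.mk_runWord {C : StronglyConnectedComponent V} (hC : IsSink C) {v : V}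
    (hv : StronglyConnectedComponent.mk v = C) (s : List (Fin d)) :
    StronglyConnectedComponent.mk (runWord c.step v s) = C := by
  induction s generalizing v with
  | nil => exact hv
  | cons a s ih => exact ih (hC.mk_step hv a)

theorem IsSink.gcd_pos [NeZero d] (c : Coloring V d) {C : StronglyConnectedComponent V}
    (hC : IsSink C) {g : ℕ} (hg : IsGcdOfCycleLengths C g) : 0 < g := by
  obtain ⟨v, hv⟩ : ∃ v, StronglyConnectedComponent.mk v = C := Quotient.mk_surjective C
  obtain ⟨⟨p⟩, -⟩ :=
    StronglyConnectedComponent.mk_eq_mk.1 ((hC.mk_step (c := c) hv 0).trans hv.symm)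
  rcases Nat.eq_zero_or_pos g with rfl | h
  · have := hg.dvd_length hv ((c.stepHom v 0).toPath.comp p)
    rw [zero_dvd_iff, Path.length_comp, Path.length_toPath] at this
    omega
  · exact h

theorem phase_runWord {C : StronglyConnectedComponent V} (hC : IsSink C) {g : ℕ}
    {φ : V → ZMod g}
    (hφ : ∀ a b : V, (a ⟶ b) → StronglyConnectedComponent.mk a = C →
        StronglyConnectedComponent.mk b = C → φ b = φ a + 1) {v : V}
    (hv : StronglyConnectedComponent.mk v = C) (s : List (Fin d)) :
    φ (runWord c.step v s) = φ v + s.length := by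
  induction s generalizing v with
  | nil => simp
  | cons a s ih =>
    rw [runWord_cons, ih (hC.mk_step hv a),
      hφ _ _ (c.stepHom v a) hv (hC.mk_step hv a), List.length_cons]
    push_cast
    ring

variable [Finite V]

/-- Among the vertices reachable from `v`, take one that reaches the fewest. -/
theorem exists_path_isSink (v : V) :
    ∃ x, Nonempty (Path v x) ∧ IsSink (StronglyConnectedComponent.mk x) := by
  have : Nonempty {x // Nonempty (Path v x)} := ⟨⟨v, ⟨Path.nil⟩⟩⟩
  obtain ⟨⟨x, ⟨p⟩⟩, hx⟩ := Finite.exists_min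
    fun x : {x // Nonempty (Path v x)} => {y | Nonempty (Path x.1 y)}.ncard
  refine ⟨x, ⟨p⟩, fun a b e ha => ?_⟩
  obtain ⟨⟨q⟩, ⟨r⟩⟩ := StronglyConnectedComponent.mk_eq_mk.1 ha
  have hsub : {y | Nonempty (Path b y)} ⊆ {y | Nonempty (Path x y)} := fun y ⟨s⟩ =>
    ⟨r.comp (e.toPath.comp s)⟩
  have heq := Set.eq_of_subset_of_ncard_le hsub (hx ⟨b, ⟨p.comp (r.cons e)⟩⟩)
  have hmem : x ∈ {y | Nonempty (Path b y)} := heq ▸ (⟨Path.nil⟩ : Nonempty (Path x x))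
  exact StronglyConnectedComponent.mk_eq_mk.2 ⟨hmem, ⟨r.cons e⟩⟩

/-- A coloring in which two states of a sink component are mergeable whenever paths of the same
length lead from them to a common vertex. -/
theorem exists_coloring_mergeable [NeZero d] (c₀ : Coloring V d) :
    ∃ c : Coloring V d, ∀ C : StronglyConnectedComponent V, IsSink C → ∀ u v : V,
      StronglyConnectedComponent.mk u = C → StronglyConnectedComponent.mk v = C →
      (∃ (x : V) (p : Path u x) (q : Path v x), p.length = q.length) →
      Mergeable c.step u v := by
  classical
  let ε : ∀ C : StronglyConnectedComponent V, IsSink C →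
      {v : V // StronglyConnectedComponent.mk v = C} → Fin d →
      {v : V // StronglyConnectedComponent.mk v = C} :=
    fun C hC v a => ⟨c₀.step v.1 a, hC.mk_step v.2 a⟩
  have hε : ∀ C hC x s, (runWord (ε C hC) x s).1 = runWord c₀.step x.1 s := by
    intro C hC x s
    induction s generalizing x with
    | nil => rfl
    | cons a s ih => exact ih _
  have htrans : ∀ C hC, IsTransitive (ε C hC) := by
    rintro C hC ⟨u, hu⟩ ⟨v, hv⟩
    obtain ⟨⟨p⟩, -⟩ := StronglyConnectedComponent.mk_eq_mk.1 (hu.trans hv.symm)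
    obtain ⟨s, -, hs⟩ := c₀.exists_word_of_path p
    exact ⟨s, Subtype.ext ((hε C hC _ s).trans hs)⟩
  choose τ hτ using fun C hC => exists_recolor_mergeable (ε C hC) (htrans C hC)
  -- Sink components are disjoint, so their recolorings glue; elsewhere the coloring is irrelevant.
  let σ : V → Equiv.Perm (Fin d) := fun v =>
    if h : IsSink (StronglyConnectedComponent.mk v) then τ _ h ⟨v, rfl⟩ else 1
  have hσ : ∀ C hC (x : {v : V // StronglyConnectedComponent.mk v = C}), σ x.1 = τ C hC x := by
    rintro C hC ⟨v, rfl⟩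
    exact dif_pos hC
  have hrun : ∀ C hC x s,
      (runWord (recolor (ε C hC) (τ C hC)) x s).1 = runWord (recolor c₀.step σ) x.1 s := by
    intro C hC x s
    induction s generalizing x with
    | nil => rfl
    | cons a s ih =>
      rw [runWord_cons, runWord_cons, ih]
      congr 1
      simp only [recolor, hσ C hC x, ε]
  refine ⟨fun v => (c₀ v).trans (σ v).symm, fun C hC u v hu hv ⟨x, p, q, hpq⟩ => ?_⟩
  change Mergeable (recolor c₀.step σ) u v
  obtain ⟨s, hs, hsx⟩ := c₀.exists_word_of_path p
  obtain ⟨t, ht, htx⟩ := c₀.exists_word_of_path q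
  obtain ⟨w, hw⟩ := hτ C hC ⟨u, hu⟩ ⟨v, hv⟩
    ⟨s, t, by omega, Subtype.ext (by rw [hε C hC, hε C hC, hsx, htx])⟩
  refine ⟨w, ?_⟩
  rw [← hrun C hC ⟨u, hu⟩, ← hrun C hC ⟨v, hv⟩, hw]

end Colorings

end RoadColoring

theorem mainTheorem4 {V : Type*} [Finite V] [Quiver V] {d : ℕ} (hd : 0 < d)
    (hV : RoadColoring.UniformOutdegree V d)
    {m : ℕ} (Γ : Fin m → Quiver.StronglyConnectedComponent V)
    (hinj : Function.Injective Γ)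
    (hsink : ∀ C : Quiver.StronglyConnectedComponent V,
      RoadColoring.IsSink C ↔ ∃ i, Γ i = C)
    (k : Fin m → ℕ) (hk : ∀ i, RoadColoring.IsGcdOfCycleLengths (Γ i) (k i)) :
    ∃ c : RoadColoring.Coloring V d, c.IsKSynchronizing (∑ i, k i) := by
  open RoadColoring Quiver in
  have : NeZero d := ⟨hd.ne'⟩
  obtain ⟨c₀⟩ := exists_coloring hd hV
  have hS : ∀ i, IsSink (Γ i) := fun i => (hsink _).2 ⟨i, rfl⟩
  have hpos : ∀ i, 0 < k i := fun i => (hS i).gcd_pos c₀ (hk i)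
  have hne : ∀ i, NeZero (k i) := fun i => ⟨(hpos i).ne'⟩
  choose φ hφ hφ' using fun i => (hk i).exists_phase (hpos i)
  have hcard : Nat.card (Σ i, ZMod (k i)) = ∑ i, k i := by
    rw [Nat.card_eq_fintype_card, Fintype.card_sigma]
    simp
  have hlower : ∀ (c : Coloring V d) (t : List (Fin d)), ∑ i, k i ≤ (c.image t).ncard := by
    intro c t
    have hex : ∀ j : Σ i, ZMod (k i), ∃ x : c.image t,
        StronglyConnectedComponent.mk x.1 = Γ j.1 ∧ φ j.1 x.1 = j.2 := by
      rintro ⟨i, z⟩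
      obtain ⟨v, hv⟩ : ∃ v, StronglyConnectedComponent.mk v = Γ i := Quotient.mk_surjective (Γ i)
      -- Chosen so that `n` letters followed by `t` carry the phase of `v` to `z`.
      set n := (z - t.length - φ i v).val with hn
      have hw := (hS i).mk_runWord (c := c) hv (List.replicate n 0)
      refine ⟨⟨runWord c.step (runWord c.step v (List.replicate n 0)) t, ⟨_, rfl⟩⟩,
        (hS i).mk_runWord hw t, ?_⟩
      rw [phase_runWord (hS i) (hφ i) hw, phase_runWord (hS i) (hφ i) hv, List.length_replicate,
        hn, ZMod.natCast_zmod_val]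
      ring
    choose f hf using hex
    rw [← hcard, ← Nat.card_coe_set_eq]
    refine Nat.card_le_card_of_injective f ?_
    rintro ⟨i, z⟩ ⟨j, y⟩ h
    have hi := hf ⟨i, z⟩
    have hj := hf ⟨j, y⟩
    rw [h] at hi
    obtain rfl : i = j := hinj (hi.1.symm.trans hj.1)
    exact congrArg _ (hi.2.symm.trans hj.2)
  obtain ⟨c, hc⟩ := exists_coloring_mergeable c₀
  obtain ⟨w, hw⟩ := exists_isMinimalWord c.step
  obtain ⟨s, hs⟩ := exists_word_forall_mem (δ := c.step)
    (S := {v | ∃ i, Γ i = StronglyConnectedComponent.mk v})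
    (fun v ⟨i, hi⟩ s => ⟨i, ((hS i).mk_runWord hi.symm s).symm⟩) (fun v => by
      obtain ⟨x, ⟨p⟩, hx⟩ := exists_path_isSink v
      obtain ⟨s, -, hs⟩ := c.exists_word_of_path p
      exact ⟨s, by rw [hs]; exact (hsink _).1 hx⟩)
  -- The letter `0` guarantees a nonempty word, and `s` moves all states into sinks.
  have hw' := (hw.append_left [0]).append s
  have hupper : (c.image ([0] ++ w ++ s)).ncard ≤ ∑ i, k i := by
    have hex : ∀ x : c.image ([0] ++ w ++ s), ∃ i, Γ i = StronglyConnectedComponent.mk x.1 := by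
      rintro ⟨_, v, rfl⟩
      have := hs (runWord c.step v ([0] ++ w))
      rwa [← runWord_append] at this
    choose f hf using hex
    rw [← hcard, ← Nat.card_coe_set_eq]
    refine Nat.card_le_card_of_injective (fun x => (⟨f x, φ (f x) x.1⟩ : Σ i, ZMod (k i))) ?_
    intro x y hxy
    have h1 : f x = f y := congrArg Sigma.fst hxy
    have h2 : φ (f x) x.1 = φ (f x) y.1 := by
      have h3 := (Sigma.mk.inj_iff.1 hxy).2
      rw [← h1] at h3
      exact eq_of_heq h3
    have hy : StronglyConnectedComponent.mk y.1 = Γ (f x) := by rw [h1, hf y]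
    -- Equal component and phase give a merging word, which is injective on the minimal image.
    obtain ⟨t, ht⟩ := hc (Γ (f x)) (hS _) x.1 y.1 (hf x).symm hy
      (hφ' (f x) x.1 y.1 (hf x).symm hy h2)
    exact Subtype.ext (hw'.injOn t x.2 y.2 ht)
  refine ⟨c, ⟨[0] ++ w ++ s, by simp, le_antisymm hupper (hlower c _), hlower c⟩, ?_⟩
  rintro c' k' s' ⟨-, rfl, -⟩
  exact hlower c' s'
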